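/- Let $d \ge 0$, let $\Delta_d = \{x \in \mathbb{R}^{d+1} : \sum_i x_i = 1,\ x_i \ge 0 \text{ for all } i\}$ be the standard $d$-simplex, and for $J \subseteq \{1,\dots,d+1\}$ let $\Delta_d^J = \{x \in \Delta_d : x_j = 0 \text{ for all } j \notin J\}$. Let $A_1, \dots, A_{d+1}$ be (relatively) open subsets of $\Delta_d$ with $\bigcup_i A_i = \Delta_d$, and let $\alpha_1, \dots, \alpha_{d+1} \colon \Delta_d \to [0,1]$ be continuous functions such that $\sum_i \alpha_i(x) = 1$ for all $x \in \Delta_d$ and such that $\alpha_i(x) > 0$ implies $x \in A_i$ (a partition of unity subordinate to the cover). Let $\alpha = (\alpha_1, \dots, \alpha_{d+1}) \colon \Delta_d \to \Delta_d$. Then at least one of the following holds: 1. $\alpha$ has a Radon partition, that is, there are disjoint sets $J, J'$ with $J \cup J' = \{1, \dots, d+1\}$ and $\alpha(\Delta_d^J) \cap \alpha(\Delta_d^{J'}) \ne \emptyset$; 2. $\bigcap_{i=1}^{d+1} A_i \ne \emptyset$. -/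

import Mathlib

/-- The face `Δ_d^J` of the simplex with vertex set `Fin (d + 1)`: the points whose coordinates
outside `J` vanish. -/
def simplexFace {d : ℕ} (J : Set (Fin (d + 1))) : Set (stdSimplex ℝ (Fin (d + 1))) :=
  {x | ∀ j, j ∉ J → (x : Fin (d + 1) → ℝ) j = 0}

/-- `f` has a Radon partition: the vertex set is a disjoint union of `J` and `J'`, and the images
under `f` of the faces spanned by `J` and by `J'` meet. -/
def HasRadonPartition {d : ℕ} {Y : Type*} (f : stdSimplex ℝ (Fin (d + 1)) → Y) : Prop :=
  ∃ J J' : Set (Fin (d + 1)), Disjoint J J' ∧ J ∪ J' = Set.univ ∧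
    (f '' simplexFace J ∩ f '' simplexFace J').Nonempty

/-- A partition of unity `α` is subordinate to the family `A` if `α i x > 0` implies `x ∈ A i`.
(This is weaker than `PartitionOfUnity.IsSubordinate`, which asks for the closed support of `α i`
to lie in `A i`.) -/
def SubordinateTo {ι X : Type*} [TopologicalSpace X] (α : PartitionOfUnity ι X)
    (A : ι → Set X) : Prop :=
  ∀ i x, 0 < α i x → x ∈ A i

/-- The continuous map `x ↦ (α i x)_i` into the simplex given by a finite partition of unity. -/
def simplexMap {ι X : Type*} [Fintype ι] [TopologicalSpace X] (α : PartitionOfUnity ι X) :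
    C(X, stdSimplex ℝ ι) where
  toFun x := ⟨fun i => α i x, fun i => α.nonneg i x, by
    have h := α.sum_eq_one (Set.mem_univ x)
    rwa [finsum_eq_sum_of_fintype] at h⟩
  continuous_toFun :=
    Continuous.subtype_mk (continuous_pi fun i => (α i).continuous) _

/-! If `α` takes a value in the interior of the simplex, every `α i` is positive at that point,
which therefore lies in every `A i`. So it suffices that a continuous self-map `f` of the simplex
without a Radon partition attains an interior value (`exists_forall_pos_of_not_hasRadonPartition`).

For `z` with coordinate sum zero, the positive parts of `z` and `-z` have the same mass `m`. Let `r
= min m 1`, and complete the two parts by the barycenter to points `p(z)` and `p(-z)` of the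
simplex. The difference of `f (p(z))` and `r • f (p(-z)) + (1 - r) • barycenter` is odd in `z` once
`m ≥ 1`, hence on the boundary of a cube, so it vanishes somewhere by a form of Borsuk–Ulam. At a
zero, `r < 1` makes `f (p(z))` interior, while `r = 1` gives a Radon partition into the positive
coordinates and the rest.

Borsuk–Ulam follows from Tucker's lemma, proved by counting mod 2. Assume no complementary edge, and
count the simplices with alternating labels in hemispheres of each dimension `n`. Both the
alternating label lists and the hemispheres have a boundary identity of the form "`b` plus `!b`",
and antipodality exchanges the two signs; so the count does not depend on `n`. It is `1` for a
single vertex and `0` for the whole cube, since `d + 1` alternating labels would need `d + 1`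
distinct indices. -/

/-! ### Alternating sign lists and their boundary mod 2 -/

/-- The sum over all positions of the value of `F` on the list with that position deleted. -/
def faceSum {V : Type*} : (List V → ZMod 2) → List V → ZMod 2
  | _, [] => 0
  | F, a :: l => F l + faceSum (fun t => F (a :: t)) l

theorem faceSum_zero {V : Type*} (l : List V) : faceSum (fun _ => 0) l = 0 := by
  induction l with
  | nil => simp [faceSum]
  | cons a l ih => simp [faceSum, ih]

theorem faceSum_perm {V : Type*} {F : List V → ZMod 2}
    (hF : ∀ l l' : List V, l.Perm l' → F l = F l') {l l' : List V} (h : l.Perm l') :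
    faceSum F l = faceSum F l' := by
  induction h generalizing F with
  | nil => rfl
  | cons a h ih =>
    simp only [faceSum]
    rw [hF _ _ h, ih fun l l' hl => hF _ _ (hl.cons a)]
  | swap a b l =>
    simp only [faceSum]
    have : (fun t => F (b :: a :: t)) = fun t => F (a :: b :: t) :=
      funext fun t => hF _ _ (List.Perm.swap a b t)
    rw [this]
    ring
  | trans _ _ ih₁ ih₂ => rw [ih₁ hF, ih₂ hF]

theorem faceSum_congr_sublist {V : Type*} {F G : List V → ZMod 2} {l : List V}
    (h : ∀ t, t.Sublist l → F t = G t) : faceSum F l = faceSum G l := by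
  induction l generalizing F G with
  | nil => rfl
  | cons a l ih =>
    simp only [faceSum]
    rw [h l (List.sublist_cons_self a l), ih fun t ht => h _ (ht.cons_cons a)]

theorem faceSum_map {V W : Type*} (g : V → W) (F : List W → ZMod 2) (l : List V) :
    faceSum F (l.map g) = faceSum (fun t => F (t.map g)) l := by
  induction l generalizing F with
  | nil => rfl
  | cons a l ih => simp [faceSum, ih]

/-- The indicator of the lists of signs that alternate and start with `b`. -/
def altSign : Bool → List Bool → ZMod 2
  | _, [] => 1
  | b, c :: l => if c = b then altSign (!b) l else 0

/-- For a nonempty alternating list only one end can be deleted: the last sign if it starts with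
`b`, the first if it starts with `!b`. Otherwise, a deletion that works removes one of two equal
neighbours, and removing the other works too, so these cancel. -/
theorem faceSum_altSign (b : Bool) (l : List Bool) :
    faceSum (altSign b) l = altSign b l + altSign (!b) l := by
  induction l generalizing b with
  | nil => simp only [faceSum, altSign]; decide
  | cons c l ih =>
    by_cases hc : c = b
    · subst hc
      simp only [faceSum, altSign, if_true, ih, Bool.not_not]
      have h := CharTwo.add_self_eq_zero (altSign c l)
      have hne : ¬ c = !c := by cases c <;> simp
      rw [if_neg hne]
      linear_combination h
    · have hc' : c = !b := by cases c <;> cases b <;> simp_all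
      simp only [faceSum, altSign, if_neg hc, faceSum_zero, if_pos hc', Bool.not_not]
      ring

theorem altSign_map_not (b : Bool) (l : List Bool) :
    altSign b (l.map (!·)) = altSign (!b) l := by
  induction l generalizing b with
  | nil => rfl
  | cons c l ih =>
    simp only [List.map_cons, altSign, ih]
    cases b <;> cases c <;> rfl

/-! ### Kuhn's triangulation of a cube -/

/-- The sum of `F` over the vertex lists of the simplices of Kuhn's triangulation of the `n`-cubes
with corner `x` and edges `e s`, `s ∈ S`. -/
def cubeSum {ι V : Type*} [DecidableEq ι] [AddCommGroup V] (e : ι → V) :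
    ℕ → Finset ι → V → (List V → ZMod 2) → ZMod 2
  | 0, _, x, F => F [x]
  | n + 1, S, x, F => ∑ s ∈ S, cubeSum e n (S.erase s) (x + e s) (fun t => F (x :: t))

section CubeSum

variable {ι V : Type*} [DecidableEq ι] [AddCommGroup V] (e : ι → V)

theorem cubeSum_add (n : ℕ) (S : Finset ι) (x : V) (F G : List V → ZMod 2) :
    cubeSum e n S x (fun t => F t + G t) = cubeSum e n S x F + cubeSum e n S x G := by
  induction n generalizing S x F G with
  | zero => rfl
  | succ n ih => simp only [cubeSum, ih, Finset.sum_add_distrib]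

theorem Finset.sum_sum_erase_comm {M : Type*} [AddCommMonoid M] (S : Finset ι) (g : ι → ι → M) :
    ∑ s ∈ S, ∑ t ∈ S.erase s, g s t = ∑ s ∈ S, ∑ t ∈ S.erase s, g t s := by
  refine Finset.sum_comm' fun s t => ?_
  simp only [Finset.mem_erase]
  tauto

theorem Finset.sum_sum_erase_symm (S : Finset ι) (g : ι → ι → ZMod 2)
    (hg : ∀ s t, g s t = g t s) : ∑ s ∈ S, ∑ t ∈ S.erase s, g s t = 0 := by
  induction S using Finset.induction_on with
  | empty => simp
  | insert a S ha ih =>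
    have h1 : ∀ s ∈ S, ∑ t ∈ (insert a S).erase s, g s t = g s a + ∑ t ∈ S.erase s, g s t := by
      intro s hs
      have hsa : s ≠ a := fun h => ha (h ▸ hs)
      rw [Finset.erase_insert_of_ne hsa.symm, Finset.sum_insert (by simp [ha])]
    rw [Finset.sum_insert ha, Finset.erase_insert ha, Finset.sum_congr rfl h1,
      Finset.sum_add_distrib, ih, add_zero, Finset.sum_congr rfl fun s _ => hg a s]
    exact CharTwo.add_self_eq_zero _

/-- Deleting an inner vertex of an edge path gives the same list as for the path with the two
adjacent edges swapped, so these terms cancel. Deleting the first or last vertex leaves a path in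
one of two opposite facets. -/
theorem cubeSum_faceSum (n : ℕ) (S : Finset ι) (x : V) (F : List V → ZMod 2) :
    cubeSum e (n + 1) S x (faceSum F) =
      ∑ s ∈ S, (cubeSum e n (S.erase s) (x + e s) F + cubeSum e n (S.erase s) x F) := by
  induction n generalizing S x F with
  | zero => simp [cubeSum, faceSum]
  | succ n ih =>
    rw [cubeSum]
    simp only [faceSum, cubeSum_add, ih, Finset.sum_add_distrib]
    congr 1
    rw [Finset.sum_sum_erase_symm, zero_add, Finset.sum_sum_erase_comm]
    · simp only [cubeSum, Finset.erase_right_comm]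
    · intro s t
      rw [Finset.erase_right_comm, add_right_comm]

theorem cubeSum_succ_last (n : ℕ) (S : Finset ι) (hS : S.card = n + 1) (x : V)
    (F : List V → ZMod 2) :
    cubeSum e (n + 1) S x F =
      ∑ s ∈ S, cubeSum e n (S.erase s) x (fun t => F (t ++ [x + ∑ i ∈ S, e i])) := by
  induction n generalizing S x F with
  | zero =>
    obtain ⟨a, rfl⟩ := Finset.card_eq_one.1 hS
    simp [cubeSum]
  | succ n ih =>
    rw [cubeSum]
    have h1 : ∀ s ∈ S, cubeSum e (n + 1) (S.erase s) (x + e s) (fun t => F (x :: t)) =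
        ∑ t ∈ S.erase s, cubeSum e n ((S.erase s).erase t) (x + e s)
          (fun l => F (x :: (l ++ [x + ∑ i ∈ S, e i]))) := by
      intro s hs
      rw [ih _ (by rw [Finset.card_erase_of_mem hs, hS]; rfl), add_assoc,
        Finset.add_sum_erase _ _ hs]
    rw [Finset.sum_congr rfl h1, Finset.sum_sum_erase_comm]
    simp only [cubeSum, Finset.erase_right_comm, List.cons_append]

/-- Each edge path is traversed backwards from the opposite corner. Combined with `cubeSum_neg`,
this makes the triangulation centrally symmetric. -/
theorem cubeSum_reverse {n : ℕ} {S : Finset ι} (hS : S.card = n) (x : V)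
    {F : List V → ZMod 2} (hF : ∀ l l' : List V, l.Perm l' → F l = F l') :
    cubeSum e n S x F = cubeSum (fun i => -e i) n S (x + ∑ i ∈ S, e i) F := by
  induction n generalizing S x F with
  | zero =>
    rw [Finset.card_eq_zero] at hS
    simp [hS, cubeSum]
  | succ n ih =>
    rw [cubeSum_succ_last e n S hS, cubeSum]
    refine Finset.sum_congr rfl fun s hs => ?_
    have : (fun t => F (t ++ [x + ∑ i ∈ S, e i])) = fun t => F ((x + ∑ i ∈ S, e i) :: t) :=
      funext fun t => hF _ _ (List.perm_append_comm)
    rw [this, ih (by rw [Finset.card_erase_of_mem hs, hS]; rfl) x fun l l' h => hF _ _ (h.cons _)]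
    congr 1
    rw [← Finset.add_sum_erase _ _ hs]
    abel

theorem cubeSum_neg (n : ℕ) (S : Finset ι) (x : V) (F : List V → ZMod 2) :
    cubeSum (fun i => -e i) n S x F = cubeSum e n S (-x) (fun l => F (l.map (-·))) := by
  induction n generalizing S x F with
  | zero => simp [cubeSum]
  | succ n ih => simp [cubeSum, ih, add_comm]

end CubeSum

theorem cubeSum_congr {ι : Type*} [DecidableEq ι] {n : ℕ} {S : Finset ι} {x : ι → ℤ}
    {F G : List (ι → ℤ) → ZMod 2}
    (h : ∀ l : List (ι → ℤ), l.length = n + 1 →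
      (∀ v ∈ l, ∀ i, x i ≤ v i ∧ v i ≤ x i + if i ∈ S then 1 else 0) → F l = G l) :
    cubeSum (fun i => Pi.single i 1) n S x F = cubeSum (fun i => Pi.single i 1) n S x G := by
  induction n generalizing S x F G with
  | zero =>
    refine h _ rfl fun v hv i => ?_
    rw [List.mem_singleton.1 hv]
    split_ifs <;> simp
  | succ n ih =>
    refine Finset.sum_congr rfl fun s hs => ih fun l hl hv => h _ (by simp [hl]) ?_
    intro v hvl i
    rcases List.mem_cons.1 hvl with rfl | hvl
    · split_ifs <;> simp
    · have := hv v hvl i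
      by_cases his : i = s
      · subst his
        simp [hs] at this ⊢
        omega
      · simpa [his] using this

/-! ### Alternating label lists -/

/-- The label with the same index and the opposite sign. -/
def flipLabel {d : ℕ} (a : Fin d ×ₗ Bool) : Fin d ×ₗ Bool :=
  toLex ((ofLex a).1, !(ofLex a).2)

/-- The indicator of the label lists whose signs, in sorted order, alternate and start with `b`. -/
def altLabel {d : ℕ} (b : Bool) (l : List (Fin d ×ₗ Bool)) : ZMod 2 :=
  altSign b (((l : Multiset (Fin d ×ₗ Bool)).sort).map fun a => (ofLex a).2)

section Labels

variable {d : ℕ}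

theorem altLabel_perm (b : Bool) {l l' : List (Fin d ×ₗ Bool)} (h : l.Perm l') :
    altLabel b l = altLabel b l' := by
  rw [altLabel, altLabel, Multiset.coe_eq_coe.2 h]

theorem altLabel_of_pairwise (b : Bool) {l : List (Fin d ×ₗ Bool)} (h : l.Pairwise (· ≤ ·)) :
    altLabel b l = altSign b (l.map fun a => (ofLex a).2) := by
  rw [altLabel, Multiset.coe_sort, List.mergeSort_eq_self _ h]

theorem faceSum_altLabel (b : Bool) (l : List (Fin d ×ₗ Bool)) :
    faceSum (altLabel b) l = altLabel b l + altLabel (!b) l := by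
  have hp : l.Perm (Multiset.sort (l : Multiset (Fin d ×ₗ Bool)) (· ≤ ·)) :=
    Multiset.coe_eq_coe.1 (Multiset.sort_eq _ _).symm
  have hs : (Multiset.sort (l : Multiset (Fin d ×ₗ Bool)) (· ≤ ·)).Pairwise (· ≤ ·) :=
    Multiset.pairwise_sort _ _
  rw [faceSum_perm (fun _ _ => altLabel_perm b) hp, altLabel_perm b hp, altLabel_perm (!b) hp,
    faceSum_congr_sublist fun t ht => altLabel_of_pairwise b (hs.sublist ht),
    altLabel_of_pairwise b hs, altLabel_of_pairwise (!b) hs, ← faceSum_altSign, faceSum_map]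

/-- The order compares indices first, and labels of equal index that are not complementary coincide.
-/
theorem flipLabel_le_flipLabel {a a' : Fin d ×ₗ Bool} (h : a' ≠ flipLabel a) :
    a ≤ a' ↔ flipLabel a ≤ flipLabel a' := by
  obtain ⟨⟨i, b⟩, rfl⟩ := toLex.surjective a
  obtain ⟨⟨j, c⟩, rfl⟩ := toLex.surjective a'
  simp only [flipLabel, ofLex_toLex, Prod.Lex.toLex_le_toLex, ne_eq, toLex_inj, Prod.mk.injEq]
    at h ⊢
  revert h
  cases b <;> cases c <;> simp +contextual [eq_comm]

theorem altLabel_map_flipLabel (b : Bool) {l : List (Fin d ×ₗ Bool)}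
    (h : ∀ a ∈ l, ∀ a' ∈ l, a' ≠ flipLabel a) :
    altLabel b (l.map flipLabel) = altLabel (!b) l := by
  rw [altLabel, ← Multiset.map_coe, ← Multiset.map_sort (r := (· ≤ ·)) (r' := (· ≤ ·)),
    List.map_map, altLabel, ← altSign_map_not, List.map_map]
  · rfl
  · intro a ha a' ha'
    exact flipLabel_le_flipLabel (h a ha a' ha')

/-- Neighbours with equal index and alternating signs would be complementary. -/
theorem isChain_of_altSign_ne_zero {b : Bool} {l : List (Fin d ×ₗ Bool)}
    (hl : l.Pairwise (· ≤ ·)) (h : ∀ a ∈ l, ∀ a' ∈ l, a' ≠ flipLabel a)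
    (hb : altSign b (l.map fun a => (ofLex a).2) ≠ 0) :
    (l.map fun a => (ofLex a).1).IsChain (· < ·) := by
  induction l generalizing b with
  | nil => simp
  | cons a l ih =>
    rw [List.map_cons, altSign] at hb
    split_ifs at hb with hab
    · have ih' := ih (List.pairwise_cons.1 hl).2
        (fun a ha a' ha' => h a (List.mem_cons_of_mem _ ha) a' (List.mem_cons_of_mem _ ha')) hb
      cases l with
      | nil => simp
      | cons a' l =>
        rw [List.map_cons, altSign] at hb
        split_ifs at hb with hab'
        · simp only [List.map_cons] at ih' ⊢
          refine List.IsChain.cons_cons ?_ ih'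
          have hle : a ≤ a' := (List.pairwise_cons.1 hl).1 a' (by simp)
          have hne := h a (by simp) a' (by simp)
          obtain ⟨⟨i, b⟩, rfl⟩ := toLex.surjective a
          obtain ⟨⟨j, c⟩, rfl⟩ := toLex.surjective a'
          simp only [flipLabel, ofLex_toLex, Prod.Lex.toLex_le_toLex, ne_eq, toLex_inj,
            Prod.mk.injEq] at hne hle hab hab' ⊢
          subst hab
          rcases hle with hle | hle
          · exact hle
          · exact (hne ⟨hle.1.symm, hab'⟩).elim
        · exact (hb rfl).elim
    · exact (hb rfl).elim

theorem altLabel_eq_zero {b : Bool} {l : List (Fin d ×ₗ Bool)}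
    (h : ∀ a ∈ l, ∀ a' ∈ l, a' ≠ flipLabel a) (hl : d < l.length) : altLabel b l = 0 := by
  by_contra hb
  have hc := isChain_of_altSign_ne_zero (Multiset.pairwise_sort _ (· ≤ ·))
    (fun a ha a' ha' => h a (by simpa using ha) a' (by simpa using ha')) hb
  have := (List.isChain_iff_pairwise.1 hc).imp (fun h => ne_of_lt h)
  have := (show List.Nodup _ from this).length_le_card
  simp at this
  omega

end Labels

/-! ### Faces of the cube and their chains -/

/-- The signs of the fixed coordinates of a face of the cube, in increasing order of coordinates;
the free coordinates are those with value `none`. -/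
def facePattern : {d : ℕ} → (Fin d → Option Bool) → List Bool
  | 0, _ => []
  | _ + 1, τ => (τ 0).toList ++ facePattern (Fin.tail τ)

theorem facePattern_map_not {d : ℕ} (τ : Fin d → Option Bool) :
    facePattern (fun i => (τ i).map (!·)) = (facePattern τ).map (!·) := by
  induction d with
  | zero => rfl
  | succ d ih =>
    have := ih (Fin.tail τ)
    simp only [facePattern, List.map_append, ← this]
    cases τ 0 <;> rfl

/-- Deleting a sign amounts to freeing a fixed coordinate. This lets `faceSum_altSign` also compute
boundaries of hemispheres. -/
theorem faceSum_facePattern {d : ℕ} (τ : Fin d → Option Bool) (F : List Bool → ZMod 2) :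
    faceSum F (facePattern τ) =
      ∑ s, if τ s = none then 0 else F (facePattern (Function.update τ s none)) := by
  induction d generalizing F with
  | zero => simp [facePattern, faceSum]
  | succ d ih =>
    have h0 : facePattern (Function.update τ 0 none) = facePattern (Fin.tail τ) := by
      simp [facePattern, Fin.tail_update_zero]
    have hs : ∀ s : Fin d, facePattern (Function.update τ s.succ none) =
        (τ 0).toList ++ facePattern (Function.update (Fin.tail τ) s none) := by
      intro s
      rw [facePattern, Fin.tail_update_succ, Function.update_of_ne (Fin.succ_ne_zero s).symm]
    rw [Fin.sum_univ_succ, h0]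
    simp only [hs]
    rw [facePattern]
    cases hτ : τ 0 with
    | none =>
      rw [Option.toList_none, List.nil_append, ih, if_pos rfl, zero_add]
      rfl
    | some b =>
      rw [Option.toList_some, List.singleton_append, faceSum, ih, if_neg (by simp)]
      rfl

theorem exists_altSign_facePattern (d : ℕ) (b : Bool) :
    ∃ τ₁ : Fin d → Option Bool, (∀ i, τ₁ i ≠ none) ∧ ∀ τ : Fin d → Option Bool,
      (∀ i, τ i ≠ none) → altSign b (facePattern τ) = if τ = τ₁ then 1 else 0 := by
  induction d generalizing b with
  | zero => exact ⟨fun i => i.elim0, fun i => i.elim0, fun τ _ => by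
      rw [if_pos (Subsingleton.elim _ _)]; rfl⟩
  | succ d ih =>
    obtain ⟨τ₁, h₁, h₂⟩ := ih (!b)
    refine ⟨Fin.cons (some b) τ₁, Fin.cases (by simp) (by simpa using h₁), fun τ hτ => ?_⟩
    have h := h₂ (Fin.tail τ) fun i => hτ i.succ
    obtain ⟨c, hc⟩ := Option.ne_none_iff_exists'.1 (hτ 0)
    have key : τ = Fin.cons (some b) τ₁ ↔ c = b ∧ Fin.tail τ = τ₁ := by
      conv_lhs => rw [← Fin.cons_self_tail τ, hc]
      rw [Fin.cons_inj, Option.some_inj]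
    simp only [facePattern, hc, Option.toList_some, List.singleton_append, altSign, h, key, ite_and]

theorem sum_Ico_int_succ_add (u : ℤ → ZMod 2) {a b : ℤ} (h : a ≤ b) :
    ∑ i ∈ Finset.Ico a b, (u (i + 1) + u i) = u b + u a := by
  induction b, h using Int.leInduction with
  | base => simp [CharTwo.add_self_eq_zero]
  | succ b h ih =>
    have : Finset.Ico a (b + 1) = insert b (Finset.Ico a b) := by
      ext i; simp only [Finset.mem_Ico, Finset.mem_insert]; omega
    rw [this, Finset.sum_insert (by simp), ih]
    linear_combination CharTwo.add_self_eq_zero (u b)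

/-- Facets shared by adjacent unit cubes cancel mod 2: the sum telescopes along coordinate `s`. -/
theorem sum_piFinset_shift_add {d : ℕ} (Q : Fin d → Finset ℤ) (s : Fin d) {a b : ℤ} (hab : a ≤ b)
    (hQ : Q s = Finset.Ico a b) (g : (Fin d → ℤ) → ZMod 2) :
    ∑ x ∈ Fintype.piFinset Q, (g (x + Pi.single s 1) + g x) =
      ∑ x ∈ Fintype.piFinset (Function.update Q s {b}), g x +
        ∑ x ∈ Fintype.piFinset (Function.update Q s {a}), g x := by
  have hshift : ∀ c, ∑ x ∈ Fintype.piFinset (Function.update Q s {c}), g (x + Pi.single s 1) =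
      ∑ x ∈ Fintype.piFinset (Function.update Q s {c + 1}), g x := by
    intro c
    refine Finset.sum_nbij' (fun x => x + Pi.single s 1) (fun x => x - Pi.single s 1) ?_ ?_
      (by simp) (by simp) (by simp)
    all_goals
      intro x hx
      rw [Fintype.mem_piFinset] at hx ⊢
      intro i
      have := hx i
      by_cases hi : i = s
      · subst hi
        simp at this ⊢
        omega
      · simpa [hi] using this
  rw [← sum_Ico_int_succ_add
    (fun c => ∑ x ∈ Fintype.piFinset (Function.update Q s {c}), g x) hab, ← hQ,
    ← Finset.sum_fiberwise_of_maps_to (g := fun x : Fin d → ℤ => x s)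
      (fun x hx => Fintype.mem_piFinset.1 hx s)]
  refine Finset.sum_congr rfl fun c hc => ?_
  rw [← Fintype.piFinset_update_singleton_eq_filter_piFinset_eq _ _ hc, Finset.sum_add_distrib,
    hshift]

/-- The lower corners' range in a coordinate of the cube `[-N, N]^d` that is free or fixed. -/
noncomputable def coordRange (N : ℤ) : Option Bool → Finset ℤ
  | none => Finset.Ico (-N) N
  | some true => {N}
  | some false => {-N}

/-- The free coordinates of a face. -/
def freeSet {d : ℕ} (τ : Fin d → Option Bool) : Finset (Fin d) :=
  Finset.univ.filter fun i => τ i = none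

/-- The sum of `F` over the simplices of Kuhn's triangulation of the face `τ` of `[-N, N]^d`. -/
noncomputable def faceChain {d : ℕ} (N : ℤ) (n : ℕ) (τ : Fin d → Option Bool)
    (F : List (Fin d → ℤ) → ZMod 2) : ZMod 2 :=
  ∑ x ∈ Fintype.piFinset fun i => coordRange N (τ i),
    cubeSum (fun i => Pi.single i 1) n (freeSet τ) x F

section Faces

variable {d : ℕ} {N : ℤ}

theorem freeSet_update_some (τ : Fin d → Option Bool) (s : Fin d) (b : Bool) :
    freeSet (Function.update τ s (some b)) = (freeSet τ).erase s := by
  ext i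
  by_cases hi : i = s <;> simp [freeSet, hi]

theorem faceChain_add (n : ℕ) (τ : Fin d → Option Bool) (F G : List (Fin d → ℤ) → ZMod 2) :
    faceChain N n τ (fun t => F t + G t) = faceChain N n τ F + faceChain N n τ G := by
  simp only [faceChain, cubeSum_add, Finset.sum_add_distrib]

theorem faceChain_faceSum (hN : 0 ≤ N) (n : ℕ) (τ : Fin d → Option Bool)
    (F : List (Fin d → ℤ) → ZMod 2) :
    faceChain N (n + 1) τ (faceSum F) =
      ∑ s ∈ freeSet τ, ∑ b, faceChain N n (Function.update τ s (some b)) F := by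
  simp only [faceChain, cubeSum_faceSum]
  rw [Finset.sum_comm]
  refine Finset.sum_congr rfl fun s hs => ?_
  have hupd : ∀ b, (fun i => coordRange N (Function.update τ s (some b) i)) =
      Function.update (fun i => coordRange N (τ i)) s (coordRange N (some b)) := by
    intro b
    ext1 i
    by_cases hi : i = s
    · subst hi; simp
    · simp [hi]
  have hs' : τ s = none := by simpa [freeSet] using hs
  rw [sum_piFinset_shift_add (fun i => coordRange N (τ i)) s (a := -N) (b := N) (by omega)
    (by simp [hs', coordRange])
    (fun x => cubeSum (fun i => Pi.single i 1) n ((freeSet τ).erase s) x F), Fintype.sum_bool]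
  simp only [hupd, freeSet_update_some]
  rfl

theorem faceChain_congr {n : ℕ} {τ : Fin d → Option Bool} {F G : List (Fin d → ℤ) → ZMod 2}
    (hN : 0 ≤ N)
    (h : ∀ l : List (Fin d → ℤ), l.length = n + 1 → (∀ v ∈ l, ∀ i, |v i| ≤ N) →
      (∀ v ∈ l, ∀ w ∈ l, ∀ i, |v i - w i| ≤ 1) →
      (∀ v ∈ l, ∀ i, τ i ≠ none → |v i| = N) → F l = G l) :
    faceChain N n τ F = faceChain N n τ G := by
  refine Finset.sum_congr rfl fun x hx => cubeSum_congr fun l hl hv => ?_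
  rw [Fintype.mem_piFinset] at hx
  have hfix : ∀ v ∈ l, ∀ i, τ i ≠ none → |v i| = N := by
    intro v hvl i hi
    have h1 := hx i
    have h2 := hv v hvl i
    rw [if_neg (by simpa [freeSet] using hi)] at h2
    obtain ⟨b, hb⟩ := Option.ne_none_iff_exists'.1 hi
    cases b <;> simp only [hb, coordRange, Finset.mem_singleton] at h1 <;>
      [rw [abs_eq_neg_self.2 (by omega)]; rw [abs_eq_self.2 (by omega)]] <;> omega
  refine h l hl (fun v hvl i => ?_) (fun v hvl w hwl i => ?_) hfix
  · by_cases hi : τ i = none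
    · have h1 := hx i
      have h2 := hv v hvl i
      rw [if_pos (by simpa [freeSet] using hi)] at h2
      simp only [hi, coordRange, Finset.mem_Ico] at h1
      rw [abs_le]; omega
    · exact (hfix v hvl i hi).le
  · have h1 := hv v hvl i
    have h2 := hv w hwl i
    rw [abs_le]
    split_ifs at h1 h2 <;> omega

/-- Central symmetry maps the triangulation of a face to that of the opposite face. -/
theorem faceChain_neg {n : ℕ} {τ : Fin d → Option Bool} (hn : (freeSet τ).card = n)
    {F : List (Fin d → ℤ) → ZMod 2} (hF : ∀ l l' : List (Fin d → ℤ), l.Perm l' → F l = F l') :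
    faceChain N n (fun i => (τ i).map (!·)) F = faceChain N n τ fun l => F (l.map (-·)) := by
  have hfree : freeSet (fun i => (τ i).map (!·)) = freeSet τ := by simp [freeSet]
  have hF' : ∀ l l' : List (Fin d → ℤ), l.Perm l' → F (l.map (-·)) = F (l'.map (-·)) :=
    fun l l' h => hF _ _ (h.map _)
  simp only [faceChain, hfree]
  have hmem : ∀ (σ : Fin d → Option Bool) (x : Fin d → ℤ),
      x ∈ Fintype.piFinset (fun i => coordRange N (σ i)) →
      -(x + ∑ j ∈ freeSet σ, (Pi.single j 1 : Fin d → ℤ)) ∈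
        Fintype.piFinset fun i => coordRange N ((σ i).map (!·)) := by
    intro σ x hx
    rw [Fintype.mem_piFinset] at hx ⊢
    intro i
    have h1 := hx i
    have hone' : (∑ j ∈ freeSet σ, (Pi.single j 1 : Fin d → ℤ)) i =
        if σ i = none then 1 else 0 := by
      simp [Finset.sum_apply, Pi.single_apply, freeSet]
    rw [Pi.neg_apply, Pi.add_apply, hone']
    rcases hσ : σ i with _ | _ | _ <;> simp [hσ, coordRange] at h1 ⊢ <;> omega
  symm
  refine Finset.sum_nbij' (fun x => -(x + ∑ j ∈ freeSet τ, Pi.single j 1))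
    (fun x => -(x + ∑ j ∈ freeSet τ, Pi.single j 1)) (hmem τ) ?_ ?_ ?_ ?_
  · intro x hx
    have := hmem _ x hx
    rw [hfree] at this
    simpa [Option.map_map, Function.comp_def] using this
  · intro x _; abel
  · intro x _; abel
  · intro x _
    rw [cubeSum_reverse _ hn x hF', cubeSum_neg]
    simp [List.map_map]

end Faces

/-! ### Hemispheres and Tucker's lemma -/

/-- The sum of `faceChain` over the `n`-dimensional faces of `[-N, N]^d` whose sign pattern
alternates and starts with `b`: a hemisphere of dimension `n` when `n < d`. -/
noncomputable def hemisphereChain {d : ℕ} (N : ℤ) (n : ℕ) (b : Bool)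
    (F : List (Fin d → ℤ) → ZMod 2) : ZMod 2 :=
  ∑ τ with (freeSet τ).card = n, altSign b (facePattern τ) * faceChain N n τ F

section Tucker

variable {d : ℕ} {N : ℤ}

theorem hemisphereChain_add (n : ℕ) (b : Bool) (F G : List (Fin d → ℤ) → ZMod 2) :
    hemisphereChain N n b (fun t => F t + G t) =
      hemisphereChain N n b F + hemisphereChain N n b G := by
  simp only [hemisphereChain, faceChain_add, mul_add, Finset.sum_add_distrib]

theorem hemisphereChain_faceSum (hN : 0 ≤ N) (n : ℕ) (b : Bool)
    (F : List (Fin d → ℤ) → ZMod 2) :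
    hemisphereChain N (n + 1) b (faceSum F) =
      hemisphereChain N n b F + hemisphereChain N n (!b) F := by
  have hl : hemisphereChain N (n + 1) b (faceSum F) =
      ∑ s, ∑ p : (Fin d → Option Bool) × Bool with (freeSet p.1).card = n + 1 ∧ p.1 s = none,
        altSign b (facePattern p.1) * faceChain N n (Function.update p.1 s (some p.2)) F := by
    simp only [hemisphereChain, faceChain_faceSum hN, Finset.mul_sum]
    simp only [Finset.sum_filter, Fintype.sum_prod_type]
    rw [Finset.sum_comm]
    refine Finset.sum_congr rfl fun τ _ => ?_
    by_cases h : (freeSet τ).card = n + 1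
    · rw [if_pos h]
      conv_lhs => rw [freeSet, Finset.sum_filter]
      refine Finset.sum_congr rfl fun s _ => ?_
      by_cases hs : τ s = none
      · simp only [h, hs, and_self, if_true]
      · simp only [hs, and_false, if_false, Finset.sum_const_zero]
    · simp only [h, false_and, if_false, Finset.sum_const_zero]
  have hr : hemisphereChain N n b F + hemisphereChain N n (!b) F =
      ∑ s, ∑ τ : Fin d → Option Bool with (freeSet τ).card = n ∧ τ s ≠ none,
        altSign b (facePattern (Function.update τ s none)) * faceChain N n τ F := by
    simp only [hemisphereChain]
    rw [← Finset.sum_add_distrib]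
    simp only [← add_mul, ← faceSum_altSign, faceSum_facePattern, Finset.sum_mul]
    simp only [Finset.sum_filter]
    rw [Finset.sum_comm]
    refine Finset.sum_congr rfl fun τ _ => ?_
    by_cases h : (freeSet τ).card = n
    · rw [if_pos h]
      refine Finset.sum_congr rfl fun s _ => ?_
      by_cases hs : τ s = none <;> simp [h, hs]
    · simp only [h, false_and, if_false, Finset.sum_const_zero]
  rw [hl, hr]
  refine Finset.sum_congr rfl fun s _ => ?_
  refine Finset.sum_nbij' (fun p => Function.update p.1 s (some p.2))
    -- The default `true` is never used, as `τ s ≠ none` here.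
    (fun τ => (Function.update τ s none, (τ s).getD true)) ?_ ?_ ?_ ?_ ?_
  · rintro ⟨τ, c⟩ h
    simp only [Finset.mem_filter, Finset.mem_univ, true_and] at h ⊢
    rw [freeSet_update_some, Finset.card_erase_of_mem (by simpa [freeSet] using h.2), h.1]
    simp
  · intro τ h
    simp only [Finset.mem_filter, Finset.mem_univ, true_and] at h ⊢
    have : freeSet (Function.update τ s none) = insert s (freeSet τ) := by
      ext i
      by_cases hi : i = s <;> simp [freeSet, hi]
    rw [this, Finset.card_insert_of_notMem (by simpa [freeSet] using h.2), h.1]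
    simp
  · rintro ⟨τ, c⟩ h
    simp only [Finset.mem_filter, Finset.mem_univ, true_and] at h
    simp [← h.2]
  · intro τ h
    simp only [Finset.mem_filter, Finset.mem_univ, true_and] at h
    obtain ⟨c, hc⟩ := Option.ne_none_iff_exists'.1 h.2
    rw [Function.update_idem, hc, Option.getD_some, ← hc, Function.update_eq_self]
  · rintro ⟨τ, c⟩ h
    simp only [Finset.mem_filter, Finset.mem_univ, true_and] at h
    simp [← h.2]

/-- **Tucker's lemma** for the cube `[-N, N]^d`. -/
theorem tucker_lemma (hN : 0 ≤ N) (lab : (Fin d → ℤ) → Fin d ×ₗ Bool)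
    (hodd : ∀ v, (∀ i, |v i| ≤ N) → (∃ i, |v i| = N) → lab (-v) = flipLabel (lab v)) :
    ∃ v w, (∀ i, |v i| ≤ N) ∧ (∀ i, |w i| ≤ N) ∧ (∀ i, |v i - w i| ≤ 1) ∧
      lab w = flipLabel (lab v) := by
  by_contra! hcon
  set F : Bool → List (Fin d → ℤ) → ZMod 2 := fun b l => altLabel b (l.map lab) with hF
  have hperm : ∀ b, ∀ l l' : List (Fin d → ℤ), l.Perm l' → F b l = F b l' :=
    fun b l l' h => altLabel_perm b (h.map lab)
  have hface : faceSum (F true) = fun l => F true l + F false l := by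
    ext l
    rw [hF, ← faceSum_map, faceSum_altLabel]
    rfl
  have hfree : ∀ τ : Fin d → Option Bool, freeSet (fun i => (τ i).map (!·)) = freeSet τ := by
    simp [freeSet]
  have hneg : ∀ n < d, hemisphereChain N n false (F true) = hemisphereChain N n true (F false) := by
    intro n hn
    refine Finset.sum_nbij' (fun τ i => (τ i).map (!·)) (fun τ i => (τ i).map (!·))
      (by simp [hfree]) (by simp [hfree]) (by simp [Option.map_map, Function.comp_def])
      (by simp [Option.map_map, Function.comp_def]) ?_
    intro τ hτ
    replace hτ : (freeSet τ).card = n := by simpa using hτ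
    -- As `n < d`, some coordinate is fixed; the face lies in the boundary, where the labelling is
    -- odd.
    obtain ⟨i, hi⟩ : ∃ i, τ i ≠ none := by
      by_contra! h
      have : (freeSet τ).card = d := by simp [freeSet, h]
      omega
    have hτ' : (freeSet fun i => (τ i).map (!·)).card = n := by rw [hfree, hτ]
    have h2 := faceChain_neg (N := N) hτ' (hperm true)
    simp only [Option.map_map, Function.comp_def, Bool.not_not, Option.map_id'] at h2
    rw [facePattern_map_not, altSign_map_not, Bool.not_true, h2]
    congr 1
    refine faceChain_congr hN fun l _ hlN hclose hfix => ?_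
    have hmap : (l.map (-·)).map lab = (l.map lab).map flipLabel := by
      rw [List.map_map, List.map_map]
      exact List.map_congr_left fun v hv => hodd v (hlN v hv) ⟨i, hfix v hv i (by simpa using hi)⟩
    have hanti : ∀ a ∈ l.map lab, ∀ a' ∈ l.map lab, a' ≠ flipLabel a := by
      simp only [List.mem_map]
      rintro _ ⟨v, hv, rfl⟩ _ ⟨w, hw, rfl⟩
      exact hcon v w (hlN v hv) (hlN w hw) (hclose v hv w hw)
    simp only [hF]
    rw [hmap, altLabel_map_flipLabel _ hanti, Bool.not_true]
  have hstep : ∀ n < d, hemisphereChain N (n + 1) true (fun l => F true l + F false l) =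
      hemisphereChain N n true (fun l => F true l + F false l) := by
    intro n hn
    rw [← hface, hemisphereChain_faceSum hN, hface, hemisphereChain_add, Bool.not_true, hneg n hn]
  have hconst : ∀ n ≤ d, hemisphereChain N n true (fun l => F true l + F false l) =
      hemisphereChain N 0 true (fun l => F true l + F false l) := by
    intro n hn
    induction n with
    | zero => rfl
    | succ n ih => rw [hstep n (by omega), ih (by omega)]
  have htop : hemisphereChain N d true (fun l => F true l + F false l) = 0 := by
    refine Finset.sum_eq_zero fun τ _ => ?_
    -- Zero is written `0 + 0` so that additivity turns the chain into `c + c = 0`.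
    rw [faceChain_congr (G := fun _ => 0 + 0) hN, faceChain_add, CharTwo.add_self_eq_zero, mul_zero]
    intro l hl hlN hclose _
    have : ∀ b, F b l = 0 := fun b => by
      refine altLabel_eq_zero ?_ (by simp [hl])
      simp only [List.mem_map]
      rintro _ ⟨v, hv, rfl⟩ _ ⟨w, hw, rfl⟩
      exact hcon v w (hlN v hv) (hlN w hw) (hclose v hv w hw)
    rw [this, this]
  have hbot : hemisphereChain N 0 true (fun l => F true l + F false l) = 1 := by
    obtain ⟨τ₁, h₁, h₂⟩ := exists_altSign_facePattern d true
    have hone : ∀ x, F true [x] + F false [x] = 1 := by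
      intro x
      simp only [hF, altLabel, List.map_singleton, Multiset.coe_singleton, Multiset.sort_singleton,
        altSign]
      cases (ofLex (lab x)).2 <;> rfl
    have hcard : ∀ i, (coordRange N (τ₁ i)).card = 1 := by
      intro i
      obtain ⟨b, hb⟩ := Option.ne_none_iff_exists'.1 (h₁ i)
      cases b <;> simp [hb, coordRange]
    rw [hemisphereChain, Finset.sum_eq_single τ₁]
    · simp [h₂ τ₁ h₁, faceChain, cubeSum, hone, hcard]
    · intro τ hτ hne
      rw [h₂ τ, if_neg hne, zero_mul]
      simpa [freeSet, Finset.filter_eq_empty_iff] using hτ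
    · intro h
      exact (h (by simpa [freeSet, Finset.filter_eq_empty_iff] using h₁)).elim
  rw [← hconst d le_rfl, htop] at hbot
  exact zero_ne_one hbot

end Tucker

/-! ### From Tucker's lemma to Borsuk–Ulam -/

/-- A continuous map on `ℝ^d` that is odd on the boundary of the cube `[-1, 1]^d` has a zero. -/
theorem exists_eq_zero_of_odd_on_cube_boundary {d : ℕ} {G : (Fin d → ℝ) → Fin d → ℝ}
    (hG : Continuous G) (hodd : ∀ w, (∃ i, |w i| = 1) → G (-w) = -G w) : ∃ w, G w = 0 := by
  rcases d with _ | d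
  · exact ⟨0, Subsingleton.elim _ _⟩
  by_contra! hne
  obtain ⟨w₀, -, hmin⟩ := (isCompact_closedBall (0 : Fin (d + 1) → ℝ) 1).exists_isMinOn
    ⟨0, by simp⟩ hG.norm.continuousOn
  have hε : 0 < ‖G w₀‖ := norm_pos_iff.2 (hne w₀)
  obtain ⟨δ, hδ, hunif⟩ := Metric.uniformContinuousOn_iff.1
    ((isCompact_closedBall (0 : Fin (d + 1) → ℝ) 1).uniformContinuousOn_of_continuous
      hG.continuousOn) _ hε
  have hmax : ∀ u : Fin (d + 1) → ℝ, ∃ i, ∀ j, |u j| ≤ |u i| := fun u =>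
    Finite.exists_max fun i => |u i|
  choose pick₀ hpick₀ using hmax
  -- The choice depends only on absolute values, so `u` and `-u` get the same index.
  let pick : (Fin (d + 1) → ℝ) → Fin (d + 1) := fun u => pick₀ fun i => |u i|
  have hpick : ∀ u : Fin (d + 1) → ℝ, ‖u‖ ≤ |u (pick u)| := fun u => by
    refine (pi_norm_le_iff_of_nonneg (abs_nonneg _)).2 fun j => ?_
    simpa using hpick₀ (fun i => |u i|) j
  have hpick_neg : ∀ u : Fin (d + 1) → ℝ, pick (-u) = pick u := fun u => by simp [pick]
  obtain ⟨N, hN⟩ := exists_nat_one_div_lt hδ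
  set M : ℤ := N + 1 with hM
  have hMpos : (0 : ℝ) < M := by rw [hM]; push_cast; positivity
  let p : (Fin (d + 1) → ℤ) → Fin (d + 1) → ℝ := fun v i => v i / M
  have hp_neg : ∀ v, p (-v) = -p v := fun v => by ext i; simp [p, neg_div]
  have hp_mem : ∀ v : Fin (d + 1) → ℤ, (∀ i, |v i| ≤ M) → p v ∈ Metric.closedBall 0 1 := by
    intro v hv
    rw [mem_closedBall_zero_iff, pi_norm_le_iff_of_nonneg zero_le_one]
    intro i
    rw [Real.norm_eq_abs, abs_div, abs_of_pos hMpos, div_le_one hMpos]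
    exact_mod_cast hv i
  have hlow : ∀ v : Fin (d + 1) → ℤ, (∀ i, |v i| ≤ M) →
      ‖G w₀‖ ≤ |G (p v) (pick (G (p v)))| := fun v hv => (hmin (hp_mem v hv)).trans (hpick _)
  obtain ⟨v, w, hv, hw, hvw, hlab⟩ := tucker_lemma (N := M) (by omega)
    (fun v => toLex (pick (G (p v)), decide (0 < G (p v) (pick (G (p v)))))) (by
      rintro v hv ⟨i, hi⟩
      have h1 : G (p (-v)) = -G (p v) := by
        rw [hp_neg]
        refine hodd _ ⟨i, ?_⟩
        rw [abs_div, abs_of_pos hMpos, div_eq_one_iff_eq hMpos.ne']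
        exact_mod_cast hi
      have h2 := hε.trans_le (hlow v hv)
      simp only [h1, hpick_neg, flipLabel, ofLex_toLex, Pi.neg_apply, Left.neg_pos_iff,
        toLex_inj, Prod.mk.injEq, true_and]
      rw [← decide_not, decide_eq_decide, not_lt]
      exact ⟨le_of_lt, fun h => lt_of_le_of_ne h (abs_pos.1 h2)⟩)
  have h1 := hlow v hv
  have h2 := hlow w hw
  have hdist : dist (p v) (p w) < δ := by
    refine lt_of_le_of_lt ((dist_pi_le_iff (by positivity)).2 fun i => ?_) hN
    rw [Real.dist_eq, ← sub_div, abs_div, abs_of_pos hMpos, hM]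
    push_cast
    gcongr
    exact_mod_cast hvw i
  have hlt := (dist_le_pi_dist (G (p v)) (G (p w)) (pick (G (p v)))).trans_lt
    (hunif _ (hp_mem v hv) _ (hp_mem w hw) hdist)
  simp only [flipLabel, ofLex_toLex, toLex_inj, Prod.mk.injEq] at hlab
  obtain ⟨hi, hs⟩ := hlab
  rw [hi] at hs h2
  rw [← decide_not, decide_eq_decide, not_lt] at hs
  rw [Real.dist_eq, abs_lt] at hlt
  -- The two values have opposite signs and size at least `‖G w₀‖`, yet differ by less than `‖G
  -- w₀‖`.
  rcases le_or_gt (G (p v) (pick (G (p v)))) 0 with h | h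
  · rw [abs_of_nonpos h] at h1
    rw [abs_of_pos (hs.2 h)] at h2
    linarith
  · have h' := not_lt.1 (mt hs.1 (not_le.2 h))
    rw [abs_of_pos h] at h1
    rw [abs_of_nonpos h'] at h2
    linarith

/-! ### Radon partitions and interior values -/

section Radon

variable {d : ℕ}

/-- The total positive part of a vector. -/
noncomputable def posMass (z : Fin (d + 1) → ℝ) : ℝ := ∑ i, max (z i) 0

theorem posMass_nonneg (z : Fin (d + 1) → ℝ) : 0 ≤ posMass z :=
  Finset.sum_nonneg fun _ _ => le_max_right _ _

theorem continuous_posMass : Continuous (posMass (d := d)) := by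
  unfold posMass; fun_prop

theorem posMass_neg {z : Fin (d + 1) → ℝ} (hz : ∑ i, z i = 0) : posMass (-z) = posMass z := by
  rw [← sub_eq_zero, ← neg_eq_zero, neg_sub, posMass, posMass, ← Finset.sum_sub_distrib]
  refine Eq.trans ?_ hz
  exact Finset.sum_congr rfl fun i _ => max_zero_sub_max_neg_zero_eq_self (z i)

theorem abs_le_posMass {z : Fin (d + 1) → ℝ} (hz : ∑ i, z i = 0) (i : Fin (d + 1)) :
    |z i| ≤ posMass z := by
  have h : ∀ z : Fin (d + 1) → ℝ, z i ≤ posMass z := fun z => (le_max_left _ _).trans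
    (Finset.single_le_sum (f := fun i => max (z i) 0) (fun _ _ => le_max_right _ _)
      (Finset.mem_univ i))
  refine abs_le'.2 ⟨h z, ?_⟩
  rw [← posMass_neg hz]
  exact h (-z)

/-- The positive mass truncated at `1`. -/
noncomputable def posRatio (z : Fin (d + 1) → ℝ) : ℝ := posMass z / max (posMass z) 1

theorem posRatio_nonneg (z : Fin (d + 1) → ℝ) : 0 ≤ posRatio z :=
  div_nonneg (posMass_nonneg z) (zero_le_one.trans (le_max_right _ _))

theorem posRatio_le_one (z : Fin (d + 1) → ℝ) : posRatio z ≤ 1 :=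
  div_le_one_of_le₀ (le_max_left _ _) (zero_le_one.trans (le_max_right _ _))

theorem posRatio_eq_one {z : Fin (d + 1) → ℝ} (h : 1 ≤ posMass z) : posRatio z = 1 := by
  rw [posRatio, max_eq_left h, div_self (by positivity)]

theorem continuous_posRatio : Continuous (posRatio (d := d)) :=
  continuous_posMass.div (continuous_posMass.max continuous_const)
    fun _ => (zero_lt_one.trans_le (le_max_right _ _)).ne'

/-- The positive part of `z`, scaled down to mass at most `1` and completed to a point of the
simplex by a multiple of the barycenter. -/
noncomputable def posPoint (z : Fin (d + 1) → ℝ) : stdSimplex ℝ (Fin (d + 1)) :=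
  ⟨fun i => max (z i) 0 / max (posMass z) 1 + (1 - posRatio z) / (d + 1), fun i => by
      have h1 := posRatio_le_one z
      have h2 : 0 ≤ max (z i) 0 / max (posMass z) 1 :=
        div_nonneg (le_max_right _ _) (zero_le_one.trans (le_max_right _ _))
      have h3 : 0 ≤ (1 - posRatio z) / ((d : ℝ) + 1) := div_nonneg (by linarith) (by positivity)
      exact add_nonneg h2 h3, by
      rw [Finset.sum_add_distrib, ← Finset.sum_div, Finset.sum_const, Finset.card_univ,
        Fintype.card_fin, nsmul_eq_mul]
      push_cast
      rw [mul_div_cancel₀ _ (by positivity)]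
      exact add_sub_cancel _ _⟩

theorem continuous_posPoint : Continuous (posPoint (d := d)) := by
  refine Continuous.subtype_mk (continuous_pi fun i => Continuous.add ?_ ?_) _
  · exact ((continuous_apply i).max continuous_const).div
      (continuous_posMass.max continuous_const)
      fun _ => (zero_lt_one.trans_le (le_max_right _ _)).ne'
  · exact (continuous_const.sub continuous_posRatio).div_const _

theorem posPoint_mem_simplexFace {z : Fin (d + 1) → ℝ} (hz : posRatio z = 1)
    {J : Set (Fin (d + 1))} (hJ : ∀ j, j ∉ J → z j ≤ 0) : posPoint z ∈ simplexFace J := by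
  intro j hj
  change max (z j) 0 / max (posMass z) 1 + (1 - posRatio z) / (d + 1) = 0
  simp [hz, max_eq_right (hJ j hj)]

/-- A continuous self-map of the simplex without a Radon partition attains a value in the
interior. -/
theorem exists_forall_pos_of_not_hasRadonPartition
    (f : C(stdSimplex ℝ (Fin (d + 1)), stdSimplex ℝ (Fin (d + 1))))
    (hf : ¬ HasRadonPartition f) : ∃ x, ∀ i, 0 < (f x : Fin (d + 1) → ℝ) i := by
  -- `L` parametrizes the sum-zero hyperplane by its first `d` coordinates.
  let L : (Fin d → ℝ) → Fin (d + 1) → ℝ := fun w => Fin.snoc w (-∑ i, w i)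
  have hL : Continuous L := continuous_pi <| Fin.lastCases
    (by simpa [L] using (by fun_prop : Continuous fun w : Fin d → ℝ => -∑ i, w i))
    fun i => by simpa [L] using continuous_apply i
  have hLsum : ∀ w, ∑ i, L w i = 0 := fun w => by simp [L, Fin.sum_univ_castSucc]
  have hLneg : ∀ w, L (-w) = -L w := fun w => by
    ext i
    refine Fin.lastCases ?_ (fun i => ?_) i <;> simp [L]
  let H : (Fin d → ℝ) → Fin (d + 1) → ℝ := fun w i =>
    (f (posPoint (L w)) : Fin (d + 1) → ℝ) i -
      (posRatio (L w) * (f (posPoint (-L w)) : Fin (d + 1) → ℝ) i +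
        (1 - posRatio (L w)) / (d + 1))
  have hHcont : Continuous H := by
    refine continuous_pi fun i => ?_
    have h1 : Continuous fun w => (f (posPoint (L w)) : Fin (d + 1) → ℝ) i :=
      (continuous_apply i).comp
        (continuous_subtype_val.comp (f.continuous.comp (continuous_posPoint.comp hL)))
    have h2 : Continuous fun w => (f (posPoint (-L w)) : Fin (d + 1) → ℝ) i :=
      (continuous_apply i).comp
        (continuous_subtype_val.comp (f.continuous.comp (continuous_posPoint.comp hL.neg)))
    have h3 : Continuous fun w => posRatio (L w) := continuous_posRatio.comp hL
    exact h1.sub ((h3.mul h2).add ((continuous_const.sub h3).div_const _))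
  have hone : ∀ y : stdSimplex ℝ (Fin (d + 1)), ∑ i, y i = 1 := fun y => y.2.2
  have hnonneg : ∀ (y : stdSimplex ℝ (Fin (d + 1))) i, 0 ≤ y i := fun y => y.2.1
  have hHsum : ∀ w, ∑ i, H w i = 0 := by
    intro w
    simp only [H]
    rw [Finset.sum_sub_distrib, Finset.sum_add_distrib, ← Finset.mul_sum,
      hone, hone, Finset.sum_const, Finset.card_univ,
      Fintype.card_fin, nsmul_eq_mul]
    push_cast
    rw [mul_div_cancel₀ _ (by positivity)]
    ring
  obtain ⟨w, hw⟩ := exists_eq_zero_of_odd_on_cube_boundary (G := fun w i => H w i.castSucc)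
    (continuous_pi fun i => (continuous_apply i.castSucc).comp hHcont) (by
      rintro w ⟨i, hi⟩
      have h1 : 1 ≤ posMass (L w) := by
        rw [← hi]
        simpa [L] using abs_le_posMass (hLsum w) i.castSucc
      have h2 := posRatio_eq_one h1
      have h3 : posRatio (-L w) = 1 := posRatio_eq_one (by rwa [posMass_neg (hLsum w)])
      ext j
      simp [H, hLneg, h2, h3])
  -- The zero covers only the first `d` coordinates; the last vanishes because the sum does.
  have hH0 : ∀ i, H w i = 0 := by
    have h0 : ∀ i : Fin d, H w i.castSucc = 0 := fun i => congrFun hw i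
    refine Fin.lastCases ?_ h0
    simpa [Fin.sum_univ_castSucc, h0] using hHsum w
  rcases (posRatio_le_one (L w)).lt_or_eq with hr | hr
  · refine ⟨posPoint (L w), fun i => ?_⟩
    have h1 : 0 < (1 - posRatio (L w)) / ((d : ℝ) + 1) :=
      div_pos (by linarith) (by positivity)
    have h2 := mul_nonneg (posRatio_nonneg (L w)) (hnonneg (f (posPoint (-L w))) i)
    have h3 := hH0 i
    simp only [H] at h3
    linarith
  · have hr' : posRatio (-L w) = 1 := by
      rw [← hr, posRatio, posRatio, posMass_neg (hLsum w)]
    refine (hf ⟨{i | 0 < L w i}, {i | 0 < L w i}ᶜ, disjoint_compl_right, Set.union_compl_self _,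
      f (posPoint (L w)), ⟨_, posPoint_mem_simplexFace hr fun j hj => not_lt.1 hj, rfl⟩,
      ⟨posPoint (-L w), posPoint_mem_simplexFace hr' fun j hj => ?_, ?_⟩⟩).elim
    · have : 0 < L w j := by simpa using hj
      simpa using this.le
    · ext i
      have h := hH0 i
      simp only [H, hr, one_mul, sub_self, zero_div, add_zero, sub_eq_zero] at h
      exact h.symm

end Radon

theorem mainTheorem6 (d : ℕ)
    (A : Fin (d + 1) → Set (stdSimplex ℝ (Fin (d + 1))))
    (hA_open : ∀ i, IsOpen (A i))
    (hA_cover : ⋃ i, A i = Set.univ)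
    (α : PartitionOfUnity (Fin (d + 1)) (stdSimplex ℝ (Fin (d + 1))))
    (hα : SubordinateTo α A) :
    HasRadonPartition (simplexMap α) ∨ (⋂ i, A i).Nonempty := by
  refine or_iff_not_imp_left.2 fun h => ?_
  obtain ⟨x, hx⟩ := exists_forall_pos_of_not_hasRadonPartition (simplexMap α) h
  exact ⟨x, Set.mem_iInter.2 fun i => hα i x (hx i)⟩
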